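/- Let $T>0$ and $d\in\mathbb N$, and let $E\colon[0,T]\times\mathbb R^d\to\mathbb R$ satisfy: (E1) $E\in C^1([0,T]\times\mathbb R^d)$ and $\nabla_xE(t,\cdot)$ is Lipschitz on bounded subsets of $\mathbb R^d$, with a constant independent of $t\in[0,T]$; (E2) there are $C_1,C_2>0$ with $|\partial_tE(t,x)|\le C_1+C_2E(t,x)$ for all $(t,x)\in[0,T]\times\mathbb R^d$; (E3) there are $C_3,C_4>0$ and $p>1$ with $C_3|x|^p-C_4\le E(t,x)$ for all $(t,x)\in[0,T]\times\mathbb R^d$; (E4) for every $(t,u)\in[0,T]\times\mathbb R^d$ the set $\{x\in\mathbb R^d:\nabla_xE(t,x)=u\}$ contains only isolated points. Let (E5) $f\colon\mathbb R^d\to\mathbb R^d$ be locally Lipschitz with $|f(u)|\le C_f(1+|u|)$ for some constant $C_f$. For $\varepsilon>0$ let $Y_{\varepsilon,t}(x_0,u_0)=(x_\varepsilon(t),u_\varepsilon(t))$, $t\in[0,T]$, be the flow map of the system $$\varepsilon\dot x=-\nabla_xE(t,x)+u,\qquad \dot u=f(u),\qquad (x(0),u(0))=(x_0,u_0).$$ Let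 $\eta_0$ be a Borel probability measure on $\mathbb R^d\times\mathbb R^d$ with compact support, let $\eta_{\varepsilon,t}:=(Y_{\varepsilon,t})_\#\eta_0$, and let $\mathcal L^1_{|[0,T]}$ be Lebesgue measure on $[0,T]$. Then for every sequence $\varepsilon_n>0$ with $\varepsilon_n\to0$ there exist a subsequence $(\varepsilon_{k_n})$ and a Borel family $\{\eta_t:t\in[0,T]\}$ of probability measures on $\mathbb R^d\times\mathbb R^d$ such that $\eta_{\varepsilon_{k_n},t}\otimes\mathcal L^1_{|[0,T]}$ converges narrowly (against bounded continuous functions of $(t,x,u)$) to $\eta_t\otimes\mathcal L^1_{|[0,T]}$. Moreover, the integrands below are integrable, and for every $\psi\in C_c(\mathbb R^d;\mathbb R^d)$, every $\theta\in C([0,T])$, every $\varphi\in C^1(\mathbb R^d)$ that is bounded together with its gradient, and every $\phi\in C^1([0,T])$ with $\phi(0)=\phi(T)=0$, $$\int_0^T\!\int_{\mathbb R^d\times\mathbb R^d}\theta(t)\,(\nabla_xE(t,x)-u)\cdot\psi(x)\,d\eta_t(x,u)\,dt=0,$$ $$\int_0^T\!\int_{\mathbb R^d\times\mathbb R^d}|\nabla_xE(t,x)-u|^2\,d\eta_t(x,u)\,dt=0,$$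 $$\int_0^T\!\int_{\mathbb R^d\times\mathbb R^d}\partial_t\phi(t)\,\varphi(u)\,d\eta_t(x,u)\,dt+\int_0^T\!\int_{\mathbb R^d\times\mathbb R^d}\phi(t)\,\nabla_u\varphi(u)\cdot f(u)\,d\eta_t(x,u)\,dt=0.$$ -/

import Mathlib

open Set Filter Topology MeasureTheory ProbabilityTheory
open scoped ENNReal BoundedContinuousFunction

/-- The state space `ℝ^d` with its Euclidean norm. -/
abbrev StateSpace (d : ℕ) : Type := EuclideanSpace ℝ (Fin d)

/-- The standing assumptions on the energy `E : [0,T] × ℝ^d → ℝ`. Only the values of `E t x` with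
`t ∈ [0,T]` matter; the time derivative is one-sided at the endpoints of `[0,T]`. -/
structure EnergyAssumptions (d : ℕ) (T : ℝ) (E : ℝ → StateSpace d → ℝ) : Prop where
  /-- `E` is of class `C¹` on `[0,T] × ℝ^d`, up to the boundary. -/
  contDiffOn : ContDiffOn ℝ 1 (fun p : ℝ × StateSpace d => E p.1 p.2) (Icc 0 T ×ˢ univ)
  /-- `∇ₓE(t,·)` is Lipschitz on bounded sets, with a constant uniform in `t ∈ [0,T]`. -/
  gradient_lipschitz : ∀ R : ℝ, ∃ L : NNReal, ∀ t ∈ Icc 0 T,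
    LipschitzOnWith L (fun x => gradient (E t) x) (Metric.closedBall 0 R)
  /-- Power control `|∂ₜE| ≤ C₁ + C₂ E`. -/
  power : ∃ C₁ > 0, ∃ C₂ > 0, ∀ t ∈ Icc 0 T, ∀ x : StateSpace d,
    |derivWithin (fun s => E s x) (Icc 0 T) t| ≤ C₁ + C₂ * E t x
  /-- Coercivity `C₃ |x|^p - C₄ ≤ E` with a real exponent `p > 1`. -/
  coercive : ∃ C₃ > 0, ∃ C₄ > 0, ∃ p : ℝ, 1 < p ∧ ∀ t ∈ Icc 0 T, ∀ x : StateSpace d,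
    C₃ * ‖x‖ ^ p - C₄ ≤ E t x
  /-- For all `t ∈ [0,T]` and `u`, the set `C(t,u) = {x : ∇ₓE(t,x) = u}` has only isolated
  points. -/
  isolated : ∀ t ∈ Icc 0 T, ∀ u x : StateSpace d, gradient (E t) x = u →
    ∃ δ > 0, ∀ y : StateSpace d, gradient (E t) y = u → dist y x < δ → y = x

/-- The standing assumptions on `f`: locally Lipschitz, with linear growth. -/
structure ControlAssumptions (d : ℕ) (f : StateSpace d → StateSpace d) : Prop where
  locallyLipschitz : LocallyLipschitz f
  linearGrowth : ∃ C : ℝ, ∀ u, ‖f u‖ ≤ C * (1 + ‖u‖)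

/-- `γ = (x,u)` solves on `[0,T]` the system `ε x' = -∇ₓE(t,x) + u`, `u' = f(u)` with
`(x,u)(0) = z₀`. -/
structure IsControlledSolution {d : ℕ} (T : ℝ) (E : ℝ → StateSpace d → ℝ)
    (f : StateSpace d → StateSpace d) (ε : ℝ) (z₀ : StateSpace d × StateSpace d)
    (γ : ℝ → StateSpace d × StateSpace d) : Prop where
  initial : γ 0 = z₀
  state : ∀ t ∈ Icc 0 T, HasDerivWithinAt (fun s => (γ s).1)
    (ε⁻¹ • (-gradient (E t) (γ t).1 + (γ t).2)) (Icc 0 T) t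
  control : ∀ t ∈ Icc 0 T, HasDerivWithinAt (fun s => (γ s).2) (f (γ t).2) (Icc 0 T) t

/-- The flow map `Y_{ε,t}`: `controlledFlow T E f ε t z₀` is the value at time `t ∈ [0,T]` of the
solution of the controlled system that starts at `z₀`. -/
noncomputable def controlledFlow {d : ℕ} (T : ℝ) (E : ℝ → StateSpace d → ℝ)
    (f : StateSpace d → StateSpace d) (ε t : ℝ) (z₀ : StateSpace d × StateSpace d) :
    StateSpace d × StateSpace d :=
  Classical.epsilon (fun γ => IsControlledSolution T E f ε z₀ γ) t

/-- The distribution `η_{ε,t} = (Y_{ε,t})_# η₀` at time `t`. -/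
noncomputable def meanFieldMeasure {d : ℕ} (T : ℝ) (E : ℝ → StateSpace d → ℝ)
    (f : StateSpace d → StateSpace d) (η₀ : Measure (StateSpace d × StateSpace d)) (ε t : ℝ) :
    Measure (StateSpace d × StateSpace d) :=
  η₀.map (controlledFlow T E f ε t)

/-- The measure `η_t ⊗ L¹|[0,T]` on time and space: for `B` Borel, its value at `B` is
`∫₀ᵀ η_t {z : (t,z) ∈ B} dt`. -/
noncomputable def timeTensor {Z : Type*} [MeasurableSpace Z] (T : ℝ) (η : ℝ → Measure Z) :
    Measure (ℝ × Z) :=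
  (volume.restrict (Icc 0 T)).bind (fun t => (η t).map (Prod.mk t))

/-- Narrow convergence of a sequence of measures: convergence against bounded continuous
functions. -/
def NarrowConverges {Z : Type*} [TopologicalSpace Z] [MeasurableSpace Z]
    (μ : ℕ → Measure Z) (ν : Measure Z) : Prop :=
  ∀ g : Z →ᵇ ℝ, Tendsto (fun n => ∫ z, g z ∂(μ n)) atTop (𝓝 (∫ z, g z ∂ν))

/-- The class `C¹_b(ℝ^d)`: `C¹` functions that are bounded together with their gradient. -/
def IsC1Bounded {d : ℕ} (φ : StateSpace d → ℝ) : Prop :=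
  ContDiff ℝ 1 φ ∧ ∃ M : ℝ, ∀ u, |φ u| ≤ M ∧ ‖gradient φ u‖ ≤ M

/-! The quantity g = E(t,x) - ⟨u,x⟩ + b has x-gradient w = ∇ₓE - u, and ε x' = -w. Along a
trajectory g therefore loses ε⁻¹|w|², and the rest of g' is at most K g + C₁ with constants
independent of ε: u is bounded by Grönwall, and superlinear coercivity lets E absorb ⟨u,x⟩. Grönwall
for g confines all trajectories that start in a given ball to one compact set, and integrating g'
gives ∫|w|² ≤ C ε (`exists_apriori_bound`). The same bound excludes blow-up, so the flow exists on
all of [0,T].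

Confinement makes the measures η_{ε,t} ⊗ dt tight. Prokhorov gives a narrow limit whose time
marginal is still Lebesgue measure, so it disintegrates into a family η_t
(`exists_subseq_timeTensor_map`). The limit may be taken against any integrand continuous on the
compact set. Taking |w|² yields w = 0 almost everywhere for the limit, hence the first two
identities. The third already holds for every ε, because χ(t) φ(u(t)) vanishes at both ends of [0,T]
(`IsControlledSolution.integral_control_eq_zero`), and it passes to the limit. -/

/-! ### Global solutions of an ODE from an a priori bound -/

section GlobalExistence

variable {V : Type*} [NormedAddCommGroup V] [NormedSpace ℝ V]

/-- The radial retraction of a normed space onto the closed ball of radius `R` around `0`. -/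
noncomputable def radialRetraction (R : ℝ) (z : V) : V := (R / max R ‖z‖) • z

theorem radialRetraction_of_norm_le {R : ℝ} (hR : 0 < R) {z : V} (hz : ‖z‖ ≤ R) :
    radialRetraction R z = z := by
  rw [radialRetraction, max_eq_left hz, div_self hR.ne', one_smul]

theorem norm_radialRetraction_le {R : ℝ} (hR : 0 < R) (z : V) : ‖radialRetraction R z‖ ≤ R := by
  have h : 0 < max R ‖z‖ := lt_max_of_lt_left hR
  rw [radialRetraction, norm_smul, Real.norm_of_nonneg (by positivity), div_mul_eq_mul_div,
    div_le_iff₀ h]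
  gcongr
  exact le_max_right _ _

/-- The difference splits into a multiple of z - w with factor at most 1 and a multiple of w that
measures the change of the radial factor. Each part is at most ‖z - w‖, whence the constant 2. -/
theorem lipschitzWith_radialRetraction {R : ℝ} (hR : 0 < R) :
    LipschitzWith 2 (radialRetraction R : V → V) := by
  refine LipschitzWith.of_dist_le_mul fun z w => ?_
  rw [dist_eq_norm, dist_eq_norm]
  set a := max R ‖z‖ with ha
  set b := max R ‖w‖ with hb
  have ha0 : 0 < a := lt_max_of_lt_left hR
  have hb0 : 0 < b := lt_max_of_lt_left hR
  have hRa : R ≤ a := le_max_left _ _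
  have hwb : ‖w‖ ≤ b := le_max_right _ _
  have hab : |b - a| ≤ ‖z - w‖ := by
    have h1 := abs_max_sub_max_le_abs ‖w‖ ‖z‖ R
    rw [max_comm _ R, max_comm _ R] at h1
    refine h1.trans ?_
    rw [norm_sub_rev]
    exact abs_norm_sub_norm_le w z
  have key : radialRetraction R z - radialRetraction R w
      = (R / a) • (z - w) + ((R / a) * ((b - a) / b)) • w := by
    have : R / a - R / b = (R / a) * ((b - a) / b) := by field_simp
    rw [← this]
    simp only [radialRetraction, ← ha, ← hb]
    module
  have hRa1 : R / a ≤ 1 := (div_le_one ha0).2 hRa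
  have hRa0 : 0 ≤ R / a := by positivity
  rw [key]
  refine (norm_add_le _ _).trans ?_
  rw [norm_smul, norm_smul, norm_mul, Real.norm_of_nonneg hRa0, norm_div, Real.norm_eq_abs,
    Real.norm_of_nonneg hb0.le]
  have h1 : R / a * ‖z - w‖ ≤ ‖z - w‖ := mul_le_of_le_one_left (norm_nonneg _) hRa1
  have h2 : R / a * (|b - a| / b) * ‖w‖ ≤ ‖z - w‖ := by
    calc R / a * (|b - a| / b) * ‖w‖ ≤ 1 * (|b - a| / b) * b := by gcongr
      _ = |b - a| := by field_simp
      _ ≤ ‖z - w‖ := hab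
  simp only [NNReal.coe_ofNat]
  linarith

/-- `γ` is continuous on `[0,τ]` and solves `γ' = F(t,γ)` on `[0,τ)`, with right derivatives. -/
structure IsRightSolution (F : ℝ → V → V) (τ : ℝ) (γ : ℝ → V) : Prop where
  continuousOn : ContinuousOn γ (Icc 0 τ)
  hasDerivWithinAt : ∀ t ∈ Ico 0 τ, HasDerivWithinAt γ (F t (γ t)) (Ici t) t

theorem isRightSolution_of_hasDerivWithinAt {F : ℝ → V → V} {T τ : ℝ} (hτ : τ ≤ T) {γ : ℝ → V}
    (h : ContinuousOn γ (Icc 0 T))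
    (h' : ∀ t ∈ Ico 0 τ, HasDerivWithinAt γ (F t (γ t)) (Icc 0 T) t) : IsRightSolution F τ γ where
  continuousOn := h.mono (Icc_subset_Icc_right hτ)
  hasDerivWithinAt t ht := by
    refine (h' t ht).mono_of_mem_nhdsWithin ?_
    exact mem_of_superset (Icc_mem_nhdsGE (ht.2.trans_le hτ)) (Icc_subset_Icc_left ht.1)

/-- Composing F with the retraction onto the ball of radius M + 1 makes it bounded and globally
Lipschitz in z, so Picard–Lindelöf applies on all of [0,T]; the bound M then keeps the solution
where the truncation is inactive. The bound is required for every τ ≤ T because it is used at the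
first time the norm reaches M + 1. -/
theorem exists_solution_of_apriori_bound [CompleteSpace V] {F : ℝ → V → V} {T : ℝ} (hT : 0 ≤ T)
    (hlip : ∀ R : ℝ, ∃ L : NNReal, ∀ t ∈ Icc 0 T, LipschitzOnWith L (F t) (Metric.closedBall 0 R))
    (hcont : ∀ z, ContinuousOn (F · z) (Icc 0 T)) (z₀ : V) {M : ℝ} (hM : 0 ≤ M)
    (hbound : ∀ τ ∈ Icc 0 T, ∀ γ, γ 0 = z₀ → IsRightSolution F τ γ → ∀ t ∈ Icc 0 τ, ‖γ t‖ ≤ M) :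
    ∃ γ : ℝ → V, γ 0 = z₀ ∧ ∀ t ∈ Icc 0 T, HasDerivWithinAt γ (F t (γ t)) (Icc 0 T) t := by
  have hR : 0 < M + 1 := by linarith
  obtain ⟨L, hL⟩ := hlip (M + 1)
  obtain ⟨B, hB⟩ := isCompact_Icc.exists_bound_of_continuousOn (hcont 0)
  have hmem : ∀ z : V, radialRetraction (M + 1) z ∈ Metric.closedBall (0 : V) (M + 1) := fun z =>
    mem_closedBall_zero_iff.2 (norm_radialRetraction_le hR z)
  set F' : ℝ → V → V := fun t z => F t (radialRetraction (M + 1) z) with hF'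
  have hB0 : 0 ≤ B := (norm_nonneg _).trans (hB 0 (left_mem_Icc.2 hT))
  have hF'b : ∀ t ∈ Icc 0 T, ∀ z, ‖F' t z‖ ≤ B + L * (M + 1) := by
    intro t ht z
    have h1 := (hL t ht).dist_le_mul _ (hmem z) 0 (by simpa using hR.le)
    rw [dist_eq_norm, dist_zero_right] at h1
    have h2 : (L : ℝ) * ‖radialRetraction (M + 1) z‖ ≤ L * (M + 1) := by
      gcongr
      exact norm_radialRetraction_le hR z
    have h3 := norm_le_norm_add_norm_sub (F t 0) (F' t z)
    have h4 := hB t ht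
    rw [norm_sub_rev] at h3
    simp only [hF'] at h3 ⊢
    linarith
  set C : NNReal := (B + L * (M + 1)).toNNReal with hC
  have hCB : (C : ℝ) = B + L * (M + 1) := Real.coe_toNNReal _ (by positivity)
  -- The truncated field is bounded by C on the whole space, so a ball of radius C T around z₀
  -- serves the full interval.
  have hPL : IsPicardLindelof F' (⟨0, left_mem_Icc.2 hT⟩ : Icc 0 T) z₀ (C * T.toNNReal) 0 C
      (L * 2) := by
    refine ⟨fun t ht => ?_, fun z _ => hcont _, fun t ht z _ => hCB ▸ hF'b t ht z, ?_⟩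
    · exact (hL t ht).comp (lipschitzWith_radialRetraction hR).lipschitzOnWith
        (fun z _ => hmem z)
    · simp [hT]
  obtain ⟨γ, h0, hγ⟩ := hPL.exists_eq_forall_mem_Icc_hasDerivWithinAt₀
  have hγc : ContinuousOn γ (Icc 0 T) := fun t ht => (hγ t ht).continuousWithinAt
  have hsmall : ∀ t ∈ Icc 0 T, ‖γ t‖ < M + 1 := by
    by_contra! hcon
    -- The infimum τ of A is the first exit time. Before τ the curve solves the original equation,
    -- so its norm at τ is at most M, against M + 1 ≤ ‖γ τ‖.
    set A := Icc 0 T ∩ (fun t => ‖γ t‖) ⁻¹' Ici (M + 1) with hA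
    have hAclosed : IsClosed A := hγc.norm.preimage_isClosed_of_isClosed isClosed_Icc isClosed_Ici
    have hAc : IsCompact A := isCompact_Icc.of_isClosed_subset hAclosed inter_subset_left
    have hAne : A.Nonempty := hcon.imp fun t ht => ⟨ht.1, ht.2⟩
    have hτ := hAc.sInf_mem hAne
    set τ := sInf A
    have hlt : ∀ t ∈ Ico 0 τ, ‖γ t‖ < M + 1 := by
      intro t ht
      by_contra! h
      exact absurd (csInf_le hAc.bddBelow ⟨⟨ht.1, ht.2.le.trans hτ.1.2⟩, h⟩) (not_le.2 ht.2)
    have hsol : IsRightSolution F τ γ := by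
      refine isRightSolution_of_hasDerivWithinAt hτ.1.2 hγc fun t ht => ?_
      have := hγ t ⟨ht.1, ht.2.le.trans hτ.1.2⟩
      rwa [show F' t (γ t) = F t (radialRetraction (M + 1) (γ t)) from rfl,
        radialRetraction_of_norm_le hR (hlt t ht).le] at this
    have h1 := hbound τ hτ.1 γ h0 hsol τ (right_mem_Icc.2 hτ.1.1)
    have h2 : M + 1 ≤ ‖γ τ‖ := hτ.2
    linarith
  refine ⟨γ, h0, fun t ht => ?_⟩
  have := hγ t ht
  rwa [show F' t (γ t) = F t (radialRetraction (M + 1) (γ t)) from rfl,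
    radialRetraction_of_norm_le hR (hsmall t ht).le] at this

end GlobalExistence

/-! ### Differentiability and coercivity of the energy -/

section Energy

variable {d : ℕ} {T : ℝ} {E : ℝ → StateSpace d → ℝ}

theorem EnergyAssumptions.hasFDerivWithinAt (hE : EnergyAssumptions d T E) {t : ℝ}
    (ht : t ∈ Icc 0 T) (x : StateSpace d) :
    HasFDerivWithinAt (fun p : ℝ × StateSpace d => E p.1 p.2)
      (fderivWithin ℝ (fun p : ℝ × StateSpace d => E p.1 p.2) (Icc 0 T ×ˢ univ) (t, x))
      (Icc 0 T ×ˢ univ) (t, x) :=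
  ((hE.contDiffOn.differentiableOn one_ne_zero) (t, x) ⟨ht, mem_univ _⟩).hasFDerivWithinAt

theorem EnergyAssumptions.hasGradientAt (hE : EnergyAssumptions d T E) {t : ℝ}
    (ht : t ∈ Icc 0 T) (x : StateSpace d) :
    HasGradientAt (E t) ((InnerProductSpace.toDual ℝ (StateSpace d)).symm
      ((fderivWithin ℝ (fun p : ℝ × StateSpace d => E p.1 p.2) (Icc 0 T ×ˢ univ) (t, x)).comp
        (ContinuousLinearMap.inr ℝ ℝ (StateSpace d)))) x := by
  rw [hasGradientAt_iff_hasFDerivAt, LinearIsometryEquiv.apply_symm_apply, ← hasFDerivWithinAt_univ]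
  exact (hE.hasFDerivWithinAt ht x).comp (f := fun y => (t, y)) x
    (hasFDerivAt_prodMk_right t x).hasFDerivWithinAt fun y _ => ⟨ht, mem_univ _⟩

theorem EnergyAssumptions.fderivWithin_apply_zero_prod (hE : EnergyAssumptions d T E) {t : ℝ}
    (ht : t ∈ Icc 0 T) (x v : StateSpace d) :
    fderivWithin ℝ (fun p : ℝ × StateSpace d => E p.1 p.2) (Icc 0 T ×ˢ univ) (t, x) (0, v) =
      inner ℝ (gradient (E t) x) v := by
  rw [(hE.hasGradientAt ht x).gradient]
  simp

theorem EnergyAssumptions.continuousOn_gradient (hT : 0 < T) (hE : EnergyAssumptions d T E) :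
    ContinuousOn (fun p : ℝ × StateSpace d => gradient (E p.1) p.2) (Icc 0 T ×ˢ univ) := by
  have h1 := hE.contDiffOn.continuousOn_fderivWithin
    ((uniqueDiffOn_Icc hT).prod uniqueDiffOn_univ) le_rfl
  have h2 : ContinuousOn (fun p : ℝ × StateSpace d =>
      (InnerProductSpace.toDual ℝ (StateSpace d)).symm
      ((fderivWithin ℝ (fun p : ℝ × StateSpace d => E p.1 p.2) (Icc 0 T ×ˢ univ) p).comp
        (ContinuousLinearMap.inr ℝ ℝ (StateSpace d)))) (Icc 0 T ×ˢ univ) :=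
    (InnerProductSpace.toDual ℝ (StateSpace d)).symm.continuous.comp_continuousOn
      (h1.clm_comp continuousOn_const)
  exact h2.congr fun p hp => (hE.hasGradientAt hp.1 p.2).gradient

theorem EnergyAssumptions.fderivWithin_apply_one_zero (hT : 0 < T) (hE : EnergyAssumptions d T E)
    {t : ℝ} (ht : t ∈ Icc 0 T) (x : StateSpace d) :
    fderivWithin ℝ (fun p : ℝ × StateSpace d => E p.1 p.2) (Icc 0 T ×ˢ univ) (t, x) (1, 0) =
      derivWithin (fun s => E s x) (Icc 0 T) t := by
  have h := (hE.hasFDerivWithinAt ht x).comp_hasDerivWithinAt (f := fun s => (s, x)) (s := Icc 0 T)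
    t ((hasDerivWithinAt_id t _).prodMk (hasDerivWithinAt_const t _ x)) fun s hs => ⟨hs, mem_univ _⟩
  exact (h.derivWithin (uniqueDiffOn_Icc hT t ht)).symm

/-- The chain rule for the energy along a curve, with right derivatives. -/
theorem EnergyAssumptions.hasDerivWithinAt_comp (hT : 0 < T) (hE : EnergyAssumptions d T E)
    {t : ℝ} (ht : t ∈ Ico 0 T) {x : ℝ → StateSpace d} {v : StateSpace d}
    (hx : HasDerivWithinAt x v (Ici t) t) :
    HasDerivWithinAt (fun s => E s (x s)) (derivWithin (fun s => E s (x t)) (Icc 0 T) t +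
      inner ℝ (gradient (E t) (x t)) v) (Ici t) t := by
  have ht' : t ∈ Icc 0 T := Ico_subset_Icc_self ht
  have h := (hE.hasFDerivWithinAt ht' (x t)).comp_hasDerivWithinAt (f := fun s => (s, x s))
    (s := Icc t T) t ((hasDerivWithinAt_id t _).prodMk (hx.mono Icc_subset_Ici_self))
    fun s hs => ⟨⟨ht.1.trans hs.1, hs.2⟩, mem_univ _⟩
  have h2 : ((1 : ℝ), v) = (1, 0) + (0, v) := by simp
  rw [h2, map_add, hE.fderivWithin_apply_one_zero hT ht', hE.fderivWithin_apply_zero_prod ht'] at h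
  exact h.mono_of_mem_nhdsWithin (Icc_mem_nhdsGE ht.2)

/-- As p > 1, the factor c r^(p-1) exceeds K beyond some r₀; below r₀ the constant |K| |r₀|
suffices. -/
theorem exists_mul_le_mul_rpow_add {c p : ℝ} (hc : 0 < c) (hp : 1 < p) (K : ℝ) :
    ∃ b, ∀ r : ℝ, 0 ≤ r → K * r ≤ c * r ^ p + b := by
  have h1 : Tendsto (fun r : ℝ => c * r ^ (p - 1)) atTop atTop :=
    (tendsto_rpow_atTop (by linarith)).const_mul_atTop hc
  obtain ⟨r₀, hr₀⟩ := (h1.eventually_ge_atTop K).exists_forall_of_atTop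
  refine ⟨|K| * |r₀|, fun r hr => ?_⟩
  have hb : 0 ≤ |K| * |r₀| := by positivity
  have hcr : 0 ≤ c * r ^ p := by positivity
  rcases le_or_gt r₀ r with h | h
  · rcases hr.eq_or_lt with rfl | hr'
    · linarith
    have h2 := mul_le_mul_of_nonneg_right (hr₀ r h) hr
    rw [mul_assoc, ← Real.rpow_add_one hr'.ne', sub_add_cancel] at h2
    linarith
  · have : K * r ≤ |K| * |r₀| := by
      calc K * r ≤ |K| * r := by gcongr; exact le_abs_self K
        _ ≤ |K| * |r₀| := by gcongr; exact h.le.trans (le_abs_self _)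
    linarith

/-- The energy dominates every multiple of the norm. -/
theorem EnergyAssumptions.exists_mul_norm_le (hE : EnergyAssumptions d T E) (K : ℝ) :
    ∃ b, 0 ≤ b ∧ ∀ t ∈ Icc 0 T, ∀ x : StateSpace d, K * ‖x‖ ≤ E t x + b := by
  obtain ⟨C₃, hC₃, C₄, -, p, hp, h⟩ := hE.coercive
  obtain ⟨b, hb⟩ := exists_mul_le_mul_rpow_add hC₃ hp K
  refine ⟨|b + C₄|, abs_nonneg _, fun t ht x => ?_⟩
  linarith [h t ht x, hb ‖x‖ (norm_nonneg x), le_abs_self (b + C₄)]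

end Energy

/-! ### Bounds uniform in ε -/

section Apriori

variable {d : ℕ} {T : ℝ} {E : ℝ → StateSpace d → ℝ} {f : StateSpace d → StateSpace d}

/-- The vector field of the controlled system. -/
noncomputable def controlledField (E : ℝ → StateSpace d → ℝ) (f : StateSpace d → StateSpace d)
    (ε t : ℝ) (z : StateSpace d × StateSpace d) : StateSpace d × StateSpace d :=
  (ε⁻¹ • (-gradient (E t) z.1 + z.2), f z.2)

/-- The equation for u involves neither x nor ε, so linear growth and Grönwall suffice. -/
theorem ControlAssumptions.exists_norm_snd_le (hf : ControlAssumptions d f) (hT : 0 ≤ T) (R : ℝ) :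
    ∃ U, 0 ≤ U ∧ ∀ ε, ∀ τ ∈ Icc 0 T, ∀ γ, IsRightSolution (controlledField E f ε) τ γ → ‖γ 0‖ ≤ R →
      ∀ t ∈ Icc 0 τ, ‖(γ t).2‖ ≤ U := by
  obtain ⟨C, hC⟩ := hf.linearGrowth
  have hC0 : 0 ≤ C := by simpa using (norm_nonneg _).trans (hC 0)
  refine ⟨gronwallBound |R| C C T, ?_, fun ε τ hτ γ hγ h0 t ht => ?_⟩
  · have := gronwallBound_mono (abs_nonneg R) hC0 hC0 hT
    rw [gronwallBound_x0] at this
    exact (abs_nonneg R).trans this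
  · have h1 := norm_le_gronwallBound_of_norm_deriv_right_le (f := fun t => (γ t).2)
      (f' := fun t => f (γ t).2) (δ := |R|) (K := C) (ε := C) hγ.continuousOn.snd
      (fun s hs => (hγ.hasDerivWithinAt s hs).snd)
      (((norm_snd_le (γ 0)).trans h0).trans (le_abs_self R))
      (fun s _ => by linarith [hC (γ s).2]) t ht
    refine h1.trans (gronwallBound_mono (abs_nonneg R) hC0 hC0 ?_)
    linarith [ht.2, hτ.2]

/-- Uniform in `ε` a priori bounds on the solutions of the controlled system and on their
dissipation. -/
theorem exists_apriori_bound (hT : 0 < T) (hE : EnergyAssumptions d T E)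
    (hf : ControlAssumptions d f) (R : ℝ) :
    ∃ M C, 0 ≤ M ∧ ∀ ε > 0, ∀ τ ∈ Icc 0 T, ∀ γ, IsRightSolution (controlledField E f ε) τ γ →
      ‖γ 0‖ ≤ R → (∀ t ∈ Icc 0 τ, ‖γ t‖ ≤ M) ∧
        ∫ t in (0)..τ, ‖gradient (E t) (γ t).1 - (γ t).2‖ ^ 2 ≤ C * ε := by
  obtain ⟨U, hU0, hU⟩ := hf.exists_norm_snd_le (E := E) hT.le R
  obtain ⟨Cf, hCf⟩ := hf.linearGrowth
  have hCf0 : 0 ≤ Cf := by simpa using (norm_nonneg _).trans (hCf 0)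
  obtain ⟨C₁, hC₁, C₂, hC₂, hpow⟩ := hE.power
  -- With the slope 2U + 1, the term ⟨u,x⟩ costs at most half of E + b, and E + b still dominates
  -- ‖x‖; hence both are at most 2g below.
  obtain ⟨b, hb0, hb⟩ := hE.exists_mul_norm_le (2 * U + 1)
  obtain ⟨e₀, he₀⟩ : ∃ e₀, ∀ x ∈ Metric.closedBall (0 : StateSpace d) R, E 0 x ≤ e₀ := by
    have hc : ContinuousOn (E 0) (Metric.closedBall 0 R) := fun x _ =>
      (hE.hasGradientAt (left_mem_Icc.2 hT.le) x).continuousAt.continuousWithinAt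
    obtain ⟨e, he⟩ := (isCompact_closedBall (0 : StateSpace d) R).bddAbove_image hc
    exact ⟨e, fun x hx => he (mem_image_of_mem _ hx)⟩
  set D := Cf * (1 + U) with hD
  have hD0 : 0 ≤ D := by positivity
  -- C₂ comes from the power control and D bounds ‖f(u)‖; the factor 2 is that of E + b ≤ 2g and ‖x‖
  -- ≤ 2g.
  set K := 2 * (C₂ + D) with hK
  have hK0 : 0 ≤ K := by positivity
  set δ := |e₀ + R * R + b| with hδ
  have hδ0 : 0 ≤ δ := abs_nonneg _
  set N := gronwallBound δ K C₁ T with hN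
  refine ⟨max (2 * N) U, δ + T * (K * N + C₁), hU0.trans (le_max_right _ _),
    fun ε hε τ hτ γ hγ h0 => ?_⟩
  have hmemT : ∀ t ∈ Icc 0 τ, t ∈ Icc 0 T := fun t ht => ⟨ht.1, ht.2.trans hτ.2⟩
  have hmemT' : ∀ t ∈ Ico 0 τ, t ∈ Ico 0 T := fun t ht => ⟨ht.1, ht.2.trans_le hτ.2⟩
  have hu := hU ε τ hτ γ hγ h0
  set x : ℝ → StateSpace d := fun t => (γ t).1
  set u : ℝ → StateSpace d := fun t => (γ t).2
  have hxc : ContinuousOn x (Icc 0 τ) := hγ.continuousOn.fst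
  have huc : ContinuousOn u (Icc 0 τ) := hγ.continuousOn.snd
  have hx' : ∀ t ∈ Ico 0 τ,
      HasDerivWithinAt x (ε⁻¹ • (-gradient (E t) (x t) + u t)) (Ici t) t :=
    fun t ht => (hγ.hasDerivWithinAt t ht).fst
  have hu' : ∀ t ∈ Ico 0 τ, HasDerivWithinAt u (f (u t)) (Ici t) t :=
    fun t ht => (hγ.hasDerivWithinAt t ht).snd
  set g : ℝ → ℝ := fun t => E t (x t) - inner ℝ (u t) (x t) + b with hg
  set w : ℝ → StateSpace d := fun t => gradient (E t) (x t) - u t with hw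
  have hwc : ContinuousOn w (Icc 0 τ) :=
    ((hE.continuousOn_gradient hT).comp (continuousOn_id.prodMk hxc)
      fun t ht => ⟨hmemT t ht, mem_univ _⟩).sub huc
  have hgc : ContinuousOn g (Icc 0 τ) :=
    ((hE.contDiffOn.continuousOn.comp (continuousOn_id.prodMk hxc)
      fun t ht => ⟨hmemT t ht, mem_univ _⟩).sub (huc.inner hxc)).add continuousOn_const
  have hinner : ∀ t ∈ Icc 0 τ, |inner ℝ (u t) (x t)| ≤ U * ‖x t‖ := fun t ht =>
    (abs_real_inner_le_norm _ _).trans (mul_le_mul_of_nonneg_right (hu t ht) (norm_nonneg _))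
  have hEg : ∀ t ∈ Icc 0 τ, E t (x t) + b ≤ 2 * g t := fun t ht => by
    have h1 := hb t (hmemT t ht) (x t)
    have h2 := (abs_le.1 (hinner t ht)).2
    have h3 := norm_nonneg (x t)
    simp only [hg]
    linarith
  have hxg : ∀ t ∈ Icc 0 τ, ‖x t‖ ≤ 2 * g t := fun t ht => by
    have h1 := hb t (hmemT t ht) (x t)
    have h2 : 0 ≤ U * ‖x t‖ := by positivity
    linarith [hEg t ht]
  set g' : ℝ → ℝ := fun t => derivWithin (fun s => E s (x t)) (Icc 0 T) t
    - inner ℝ (f (u t)) (x t) - ε⁻¹ * ‖w t‖ ^ 2 with hg'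
  have hderiv : ∀ t ∈ Ico 0 τ, HasDerivWithinAt g (g' t) (Ici t) t := fun t ht => by
    have h1 := ((hE.hasDerivWithinAt_comp hT (hmemT' t ht) (hx' t ht)).sub
      ((hu' t ht).inner ℝ (hx' t ht))).add_const b
    refine h1.congr_deriv ?_
    have hwt : gradient (E t) (x t) = w t + u t := by simp [hw]
    rw [hwt, show -(w t + u t) + u t = -w t by abel]
    simp only [hg', inner_smul_right, inner_neg_right, inner_add_left,
      real_inner_self_eq_norm_sq]
    ring
  have hbound : ∀ t ∈ Ico 0 τ, g' t ≤ K * g t + C₁ - ε⁻¹ * ‖w t‖ ^ 2 := fun t ht => by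
    have ht' := Ico_subset_Icc_self ht
    have h1 := (le_abs_self _).trans (hpow t (hmemT t ht') (x t))
    have h2 : -inner ℝ (f (u t)) (x t) ≤ D * ‖x t‖ := by
      refine (neg_le_abs _).trans ((abs_real_inner_le_norm _ _).trans ?_)
      have : ‖f (u t)‖ ≤ D := (hCf _).trans (by rw [hD]; gcongr; exact hu t ht')
      gcongr
    have h3 : D * ‖x t‖ ≤ D * (2 * g t) := by gcongr; exact hxg t ht'
    have h4 : C₂ * (E t (x t) + b) ≤ C₂ * (2 * g t) := by gcongr; exact hEg t ht'
    have h5 : 0 ≤ C₂ * b := by positivity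
    simp only [hg', hK]
    linarith
  have hdiss : ∀ t, 0 ≤ ε⁻¹ * ‖w t‖ ^ 2 := fun t => by positivity
  have hg0 : g 0 ≤ δ := by
    have h1 : E 0 (x 0) ≤ e₀ :=
      he₀ _ (mem_closedBall_zero_iff.2 ((norm_fst_le (γ 0)).trans h0))
    have h2 : -inner ℝ (u 0) (x 0) ≤ R * R := by
      refine (neg_le_abs _).trans ((abs_real_inner_le_norm _ _).trans ?_)
      exact mul_le_mul ((norm_snd_le (γ 0)).trans h0) ((norm_fst_le (γ 0)).trans h0)
        (norm_nonneg _) ((norm_nonneg _).trans h0)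
    have h3 : g 0 ≤ e₀ + R * R + b := by simp only [hg]; linarith
    exact h3.trans (le_abs_self _)
  have hgN : ∀ t ∈ Icc 0 τ, g t ≤ N := fun t ht => by
    have h1 := le_gronwallBound_of_liminf_deriv_right_le (f' := g') (δ := δ) (K := K) (ε := C₁) hgc
      (fun s hs r hr => (hderiv s hs).liminf_right_slope_le hr) hg0
      (fun s hs => by linarith [hbound s hs, hdiss s]) t ht
    refine h1.trans (gronwallBound_mono hδ0 hC₁.le hK0 ?_)
    linarith [ht.2, hτ.2]
  refine ⟨fun t ht => ?_, ?_⟩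
  · rw [Prod.norm_def]
    refine max_le_max ?_ (hu t ht)
    linarith [hxg t ht, hgN t ht]
  · have hint : IntegrableOn (fun t => (K * N + C₁) - ε⁻¹ * ‖w t‖ ^ 2) (Icc 0 τ) :=
      (continuousOn_const.sub (continuousOn_const.mul (hwc.norm.pow 2))).integrableOn_Icc
    -- Integrating g' ≤ K N + C₁ - ε⁻¹‖w‖² and using g(τ) ≥ 0 and g(0) ≤ δ bounds the dissipation by
    -- a constant times ε.
    have h1 := intervalIntegral.sub_le_integral_of_hasDeriv_right_of_le hτ.1 hgc
      (fun t ht => (hderiv t (Ioo_subset_Ico_self ht)).mono Ioi_subset_Ici_self) hint fun t ht => by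
        have h2 : K * g t ≤ K * N := by gcongr; exact hgN t (Ioo_subset_Icc_self ht)
        linarith [hbound t (Ioo_subset_Ico_self ht)]
    have hwi : IntervalIntegrable (fun t => ‖w t‖ ^ 2) volume 0 τ :=
      ContinuousOn.intervalIntegrable_of_Icc hτ.1 (hwc.norm.pow 2)
    rw [intervalIntegral.integral_sub intervalIntegrable_const (hwi.const_mul _),
      intervalIntegral.integral_const, intervalIntegral.integral_const_mul, sub_zero,
      smul_eq_mul] at h1
    have h3 : 0 ≤ g τ := by
      have hτm := right_mem_Icc.2 hτ.1
      linarith [hxg τ hτm, norm_nonneg (x τ)]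
    have hN0 : 0 ≤ N := by
      have hm := left_mem_Icc.2 hτ.1
      linarith [hxg 0 hm, hgN 0 hm, norm_nonneg (x 0)]
    have h4 : τ * (K * N + C₁) ≤ T * (K * N + C₁) := by gcongr; exact hτ.2
    have h5 : ε⁻¹ * ∫ t in (0)..τ, ‖w t‖ ^ 2 ≤ δ + T * (K * N + C₁) := by linarith
    rwa [inv_mul_le_iff₀ hε, mul_comm ε] at h5

end Apriori

/-! ### Existence and continuity of the flow -/

section Flow

variable {d : ℕ} {T : ℝ} {E : ℝ → StateSpace d → ℝ} {f : StateSpace d → StateSpace d}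

theorem isControlledSolution_iff {ε : ℝ} {z₀ : StateSpace d × StateSpace d}
    {γ : ℝ → StateSpace d × StateSpace d} :
    IsControlledSolution T E f ε z₀ γ ↔ γ 0 = z₀ ∧
      ∀ t ∈ Icc 0 T, HasDerivWithinAt γ (controlledField E f ε t (γ t)) (Icc 0 T) t :=
  ⟨fun h => ⟨h.initial, fun t ht => (h.state t ht).prodMk (h.control t ht)⟩,
    fun h => ⟨h.1, fun t ht => (h.2 t ht).fst, fun t ht => (h.2 t ht).snd⟩⟩

theorem IsControlledSolution.continuousOn {ε : ℝ} {z₀ : StateSpace d × StateSpace d}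
    {γ : ℝ → StateSpace d × StateSpace d} (h : IsControlledSolution T E f ε z₀ γ) :
    ContinuousOn γ (Icc 0 T) := fun t ht =>
  ((isControlledSolution_iff.1 h).2 t ht).continuousWithinAt

theorem IsControlledSolution.isRightSolution {ε : ℝ} {z₀ : StateSpace d × StateSpace d}
    {γ : ℝ → StateSpace d × StateSpace d} (h : IsControlledSolution T E f ε z₀ γ) :
    IsRightSolution (controlledField E f ε) T γ :=
  isRightSolution_of_hasDerivWithinAt le_rfl h.continuousOn fun t ht =>
    (isControlledSolution_iff.1 h).2 t (Ico_subset_Icc_self ht)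

theorem exists_lipschitzOnWith_controlledField (hE : EnergyAssumptions d T E)
    (hf : ControlAssumptions d f) (ε R : ℝ) :
    ∃ L : NNReal, ∀ t ∈ Icc 0 T,
      LipschitzOnWith L (controlledField E f ε t) (Metric.closedBall 0 R) := by
  obtain ⟨L₁, hL₁⟩ := hE.gradient_lipschitz R
  obtain ⟨L₂, hL₂⟩ := (hf.locallyLipschitz.locallyLipschitzOn
    (s := Metric.closedBall 0 R)).exists_lipschitzOnWith_of_compact (isCompact_closedBall _ _)
  have hfst : MapsTo Prod.fst (Metric.closedBall (0 : StateSpace d × StateSpace d) R)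
      (Metric.closedBall 0 R) := fun z hz =>
    mem_closedBall_zero_iff.2 ((norm_fst_le z).trans (mem_closedBall_zero_iff.1 hz))
  have hsnd : MapsTo Prod.snd (Metric.closedBall (0 : StateSpace d × StateSpace d) R)
      (Metric.closedBall 0 R) := fun z hz =>
    mem_closedBall_zero_iff.2 ((norm_snd_le z).trans (mem_closedBall_zero_iff.1 hz))
  refine ⟨max (‖ε⁻¹‖₊ * (L₁ * 1 + 1)) (L₂ * 1), fun t ht => ?_⟩
  have h1 := (((hL₁ t ht).comp LipschitzWith.prod_fst.lipschitzOnWith hfst).neg.add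
    LipschitzWith.prod_snd.lipschitzOnWith)
  exact ((lipschitzWith_smul ε⁻¹).comp_lipschitzOnWith h1).prodMk
    (hL₂.comp LipschitzWith.prod_snd.lipschitzOnWith hsnd)

theorem isControlledSolution_controlledFlow (hT : 0 < T) (hE : EnergyAssumptions d T E)
    (hf : ControlAssumptions d f) {ε : ℝ} (hε : 0 < ε) (z₀ : StateSpace d × StateSpace d) :
    IsControlledSolution T E f ε z₀ (fun t => controlledFlow T E f ε t z₀) := by
  obtain ⟨M, C, hM, h⟩ := exists_apriori_bound hT hE hf ‖z₀‖
  obtain ⟨γ, hγ⟩ := exists_solution_of_apriori_bound (F := controlledField E f ε) hT.le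
    (exists_lipschitzOnWith_controlledField hE hf ε)
    (fun z => ((((hE.continuousOn_gradient hT).comp (continuousOn_id.prodMk continuousOn_const)
      fun t ht => ⟨ht, mem_univ _⟩).neg.add continuousOn_const).const_smul ε⁻¹).prodMk
        continuousOn_const) z₀ hM
    (fun τ hτ γ h0 hγ => (h ε hε τ hτ γ hγ (by rw [h0])).1)
  exact Classical.epsilon_spec (p := fun γ => IsControlledSolution T E f ε z₀ γ)
    ⟨γ, isControlledSolution_iff.2 hγ⟩

/-- The flow stays in a compact set and dissipates, uniformly in `ε` and locally uniformly in the
initial datum. -/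
theorem exists_controlledFlow_bound (hT : 0 < T) (hE : EnergyAssumptions d T E)
    (hf : ControlAssumptions d f) (R : ℝ) :
    ∃ M C, ∀ ε > 0, ∀ z ∈ Metric.closedBall (0 : StateSpace d × StateSpace d) R,
      (∀ t ∈ Icc 0 T, controlledFlow T E f ε t z ∈ Metric.closedBall 0 M) ∧
        ∫ t in Icc 0 T, ‖gradient (E t) (controlledFlow T E f ε t z).1
          - (controlledFlow T E f ε t z).2‖ ^ 2 ≤ C * ε := by
  obtain ⟨M, C, -, h⟩ := exists_apriori_bound hT hE hf R
  refine ⟨M, C, fun ε hε z hz => ?_⟩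
  have hsol := isControlledSolution_controlledFlow hT hE hf hε z
  obtain ⟨h1, h2⟩ := h ε hε T (right_mem_Icc.2 hT.le) _ hsol.isRightSolution
    (by rw [hsol.initial]; exact mem_closedBall_zero_iff.1 hz)
  refine ⟨fun t ht => mem_closedBall_zero_iff.2 (h1 t ht), ?_⟩
  rwa [integral_Icc_eq_integral_Ioc, ← intervalIntegral.integral_of_le hT.le]

/-- Trajectories from a ball of data share one ball, on which the field is Lipschitz. Grönwall makes
the flow Lipschitz in the datum uniformly in t, which together with continuity in t gives joint
continuity. -/
theorem continuousOn_controlledFlow (hT : 0 < T) (hE : EnergyAssumptions d T E)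
    (hf : ControlAssumptions d f) {ε : ℝ} (hε : 0 < ε) (R : ℝ) :
    ContinuousOn (fun p : ℝ × StateSpace d × StateSpace d => controlledFlow T E f ε p.1 p.2)
      (Icc 0 T ×ˢ Metric.closedBall 0 R) := by
  obtain ⟨M, C, h⟩ := exists_controlledFlow_bound hT hE hf R
  obtain ⟨L, hL⟩ := exists_lipschitzOnWith_controlledField hE hf ε M
  have hsol := isControlledSolution_controlledFlow hT hE hf hε
  refine continuousOn_prod_of_continuousOn_lipschitzOnWith' _ (Real.exp (L * T)).toNNReal
    (fun t ht => LipschitzOnWith.of_dist_le_mul fun z hz w hw => ?_)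
    (fun z _ => (hsol z).continuousOn)
  have h1 := dist_le_of_trajectories_ODE_of_mem (v := controlledField E f ε)
    (s := fun _ => Metric.closedBall 0 M) (δ := dist z w)
    (fun s hs => hL s (Ico_subset_Icc_self hs))
    (hsol z).continuousOn (hsol z).isRightSolution.hasDerivWithinAt
    (fun s hs => (h ε hε z hz).1 s (Ico_subset_Icc_self hs))
    (hsol w).continuousOn (hsol w).isRightSolution.hasDerivWithinAt
    (fun s hs => (h ε hε w hw).1 s (Ico_subset_Icc_self hs))
    (by rw [(hsol z).initial, (hsol w).initial]) t ht
  refine h1.trans ?_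
  rw [Real.coe_toNNReal _ (Real.exp_nonneg _), mul_comm]
  gcongr
  linarith [ht.2]

end Flow

/-! ### Narrow convergence on a common compact set -/

section NarrowConvergence

variable {X : Type*} [TopologicalSpace X] [MeasurableSpace X]

/-- Narrow convergence of measures that are concentrated on a common compact set extends to
integrands that are continuous on this set only. -/
theorem NarrowConverges.tendsto_integral_of_continuousOn [T2Space X] [NormalSpace X]
    {μ : ℕ → Measure X} {ν : Measure X}
    (h : NarrowConverges μ ν) {K : Set X} (hK : IsCompact K) (hμ : ∀ n, μ n Kᶜ = 0)
    (hν : ν Kᶜ = 0) {g : X → ℝ} (hg : ContinuousOn g K) :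
    Tendsto (fun n => ∫ z, g z ∂(μ n)) atTop (𝓝 (∫ z, g z ∂ν)) := by
  have : CompactSpace K := isCompact_iff_compactSpace.1 hK
  let g₀ : K →ᵇ ℝ := BoundedContinuousFunction.mkOfCompact ⟨K.domRestrict g, hg.domRestrict⟩
  -- Tietze extension: G is bounded and continuous everywhere and agrees with g on K, which carries
  -- all the measures.
  obtain ⟨G, -, hG⟩ := BoundedContinuousFunction.exists_norm_eq_domRestrict_eq_of_closed g₀
    hK.isClosed
  have hGg : ∀ z ∈ K, G z = g z := fun z hz => by
    have := DFunLike.congr_fun hG ⟨z, hz⟩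
    simpa [g₀] using! this
  have hae : ∀ m : Measure X, m Kᶜ = 0 → ∫ z, G z ∂m = ∫ z, g z ∂m := fun m hm => by
    refine integral_congr_ae ?_
    have : ∀ᵐ z ∂m, z ∈ K := by rwa [ae_iff]
    filter_upwards [this] with z hz using hGg z hz
  have := h G
  simp only [hae _ hν, hae _ (hμ _)] at this
  exact this

/-- Sequential compactness of the probability measures on a given compact set. -/
theorem exists_subseq_narrowConverges [BorelSpace X] [TopologicalSpace.MetrizableSpace X]
    [TopologicalSpace.SeparableSpace X]
    {K : Set X} (hK : IsCompact K) (μ : ℕ → Measure X) [∀ n, IsProbabilityMeasure (μ n)]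
    (hμ : ∀ n, μ n Kᶜ = 0) :
    ∃ ν : Measure X, IsProbabilityMeasure ν ∧ ν Kᶜ = 0 ∧
      ∃ k : ℕ → ℕ, StrictMono k ∧ NarrowConverges (fun n => μ (k n)) ν := by
  let P : ℕ → ProbabilityMeasure X := fun n => ⟨μ n, inferInstance⟩
  -- Prokhorov's theorem, with K as the tightness set and tolerance 0 at every level.
  have hc := isCompact_setOfPred_probabilityMeasure_mass_eq_compl_isCompact_le
    (E := X) (u := fun _ => 0) (K := fun _ => K) tendsto_const_nhds (fun _ => hK)
    (Or.inr monotone_const)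
  have hP : ∀ n, P n ∈ {m : ProbabilityMeasure X | ∀ _ : ℕ, m Kᶜ ≤ 0} := fun n _ =>
    le_of_eq ((ProbabilityMeasure.null_iff_toMeasure_null _ _).2 (hμ n))
  obtain ⟨ν, hν, k, hk, hlim⟩ := hc.tendsto_subseq hP
  refine ⟨ν, inferInstance, ?_, k, hk, fun g => ?_⟩
  · exact (ProbabilityMeasure.null_iff_toMeasure_null _ _).1 (le_zero_iff.1 (hν 0))
  · exact ProbabilityMeasure.tendsto_iff_forall_integral_tendsto.1 hlim g

/-- Sequential compactness of the measures of a given mass on a given compact set. -/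
theorem exists_subseq_narrowConverges_of_measure_univ_eq [BorelSpace X]
    [TopologicalSpace.MetrizableSpace X]
    [TopologicalSpace.SeparableSpace X]
    {K : Set X} (hK : IsCompact K) {c : ℝ≥0∞} (hc0 : c ≠ 0) (hc : c ≠ ∞) (μ : ℕ → Measure X)
    (hmass : ∀ n, μ n univ = c) (hμ : ∀ n, μ n Kᶜ = 0) :
    ∃ ν : Measure X, IsFiniteMeasure ν ∧ ν Kᶜ = 0 ∧
      ∃ k : ℕ → ℕ, StrictMono k ∧ NarrowConverges (fun n => μ (k n)) ν := by
  have : ∀ n, IsProbabilityMeasure (c⁻¹ • μ n) := fun n =>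
    ⟨by simp [hmass, ENNReal.inv_mul_cancel hc0 hc]⟩
  obtain ⟨ν, hν, hνK, k, hk, hlim⟩ :=
    exists_subseq_narrowConverges hK (fun n => c⁻¹ • μ n) fun n => by simp [hμ n]
  refine ⟨c • ν, ν.smul_finite hc, by simp [hνK], k, hk, fun g => ?_⟩
  have := (hlim g).const_mul c.toReal
  have hne : c.toReal ≠ 0 := (ENNReal.toReal_pos hc0 hc).ne'
  simpa [integral_smul_measure, ENNReal.toReal_inv, hne] using this

end NarrowConvergence

/-! ### Time tensors, push-forwards and disintegration -/

section TimeTensor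

variable {Z : Type*} [MeasurableSpace Z]

theorem timeTensor_kernel (T : ℝ) (η : Kernel ℝ Z) [IsSFiniteKernel η] :
    timeTensor T η = (volume.restrict (Icc 0 T)) ⊗ₘ η := by
  have hm : Measurable fun t => (η t).map (Prod.mk t) := by
    refine Measure.measurable_of_measurable_coe _ fun s hs => ?_
    have : (fun t => (η t).map (Prod.mk t) s) = fun t => η t (Prod.mk t ⁻¹' s) := by
      ext t
      rw [Measure.map_apply measurable_prodMk_left hs]
    rw [this]
    exact Kernel.measurable_kernel_prodMk_left hs
  ext s hs
  rw [timeTensor, Measure.bind_apply hs hm.aemeasurable, Measure.compProd_apply hs]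
  exact lintegral_congr fun t => Measure.map_apply measurable_prodMk_left hs

/-- The time tensor of a family of push-forwards of one measure is the push-forward of a product
measure. -/
theorem timeTensor_map (T : ℝ) {W : Type*} [MeasurableSpace W] (m : Measure W) [SFinite m]
    (Y : ℝ → W → Z) (hY : AEMeasurable (fun p : ℝ × W => Y p.1 p.2)
      ((volume.restrict (Icc 0 T)).prod m)) :
    timeTensor T (fun t => m.map (Y t)) =
      ((volume.restrict (Icc 0 T)).prod m).map (fun p => (p.1, Y p.1 p.2)) := by
  -- Y is only almost everywhere measurable in (t,w), so the computation runs with a measurable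
  -- version Y'.
  obtain ⟨Y', hY', hae⟩ := hY
  have hae' := Measure.ae_ae_of_ae_prod hae
  have h1 : timeTensor T (fun t => m.map (Y t)) =
      (volume.restrict (Icc 0 T)).bind fun t => m.map fun w => (t, Y' (t, w)) := by
    refine Measure.bind_congr_right ?_
    filter_upwards [hae'] with t ht
    rw [Measure.map_congr ht, Measure.map_map measurable_prodMk_left (by fun_prop)]
    rfl
  have h2 : ((volume.restrict (Icc 0 T)).prod m).map (fun p => (p.1, Y p.1 p.2)) =
      ((volume.restrict (Icc 0 T)).prod m).map (fun p => (p.1, Y' p)) := by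
    refine Measure.map_congr ?_
    filter_upwards [hae] with p hp using by rw [hp]
  have hm : Measurable fun p : ℝ × W => (p.1, Y' p) := by fun_prop
  rw [h1, h2]
  have happ : ∀ s, MeasurableSet s → ∀ t, m.map (fun w => (t, Y' (t, w))) s
      = m (Prod.mk t ⁻¹' ((fun p : ℝ × W => (p.1, Y' p)) ⁻¹' s)) := fun s hs t => by
    rw [Measure.map_apply (by fun_prop) hs]
    rfl
  have hmm : Measurable fun t => m.map fun w => (t, Y' (t, w)) := by
    refine Measure.measurable_of_measurable_coe _ fun s hs => ?_
    simp only [happ s hs]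
    exact measurable_measure_prodMk_left (hm hs)
  ext s hs
  rw [Measure.bind_apply hs hmm.aemeasurable, Measure.map_apply hm hs,
    Measure.prod_apply (hm hs)]
  exact lintegral_congr (happ s hs)

/-- A narrow limit of measures on `ℝ × Z` with time marginal Lebesgue measure on `[0,T]`
disintegrates into a Markov kernel. -/
theorem NarrowConverges.exists_kernel [TopologicalSpace Z] [BorelSpace Z] [StandardBorelSpace Z]
    [Nonempty Z] [SecondCountableTopology Z] {T : ℝ} {μ : ℕ → Measure (ℝ × Z)} {ν : Measure (ℝ × Z)}
    [IsFiniteMeasure ν] (h : NarrowConverges μ ν)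
    (hμ : ∀ n, (μ n).fst = volume.restrict (Icc 0 T)) :
    ∃ η : Kernel ℝ Z, IsMarkovKernel η ∧ timeTensor T η = ν := by
  -- Test functions of t alone have constant integrals along the sequence, so the time marginal
  -- survives in the limit.
  have hfst : ν.fst = volume.restrict (Icc 0 T) := by
    have : IsFiniteMeasure ν.fst := by infer_instance
    refine ext_of_forall_integral_eq_of_IsFiniteMeasure fun g => ?_
    have h1 := h (g.compContinuous ⟨Prod.fst, continuous_fst⟩)
    have h2 : ∀ m : Measure (ℝ × Z),
        ∫ z, g.compContinuous ⟨Prod.fst, continuous_fst⟩ z ∂m = ∫ t, g t ∂m.fst := fun m => by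
      rw [Measure.fst, integral_map measurable_fst.aemeasurable
        g.continuous.aestronglyMeasurable]
      rfl
    simp only [h2, hμ] at h1
    exact tendsto_nhds_unique h1 tendsto_const_nhds
  refine ⟨ν.condKernel, inferInstance, ?_⟩
  rw [timeTensor_kernel, ← hfst, ν.disintegrate ν.condKernel]

end TimeTensor

/-! ### Limits of families of curves -/

section PushforwardLimit

theorem integrable_of_continuousOn_of_isCompact {X : Type*} [TopologicalSpace X]
    [TopologicalSpace.PseudoMetrizableSpace X] [MeasurableSpace X] [OpensMeasurableSpace X]
    {μ : Measure X} [IsFiniteMeasure μ] {K : Set X} (hK : IsCompact K) (hKm : MeasurableSet K)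
    (hμ : μ Kᶜ = 0) {g : X → ℝ} (hg : ContinuousOn g K) : Integrable g μ := by
  have h := hg.integrableOn_compact' hK hKm (μ := μ)
  rwa [IntegrableOn, Measure.restrict_eq_self_of_ae_mem (by rwa [ae_iff])] at h

variable {Z W : Type*} [MetricSpace Z] [SecondCountableTopology Z] [CompleteSpace Z]
  [MeasurableSpace Z] [BorelSpace Z] [Nonempty Z]
  [TopologicalSpace W] [SecondCountableTopology W] [MeasurableSpace W] [OpensMeasurableSpace W]

/-- Curves that depend continuously on their label and stay in a common compact set: the time
tensors of the push-forwards of a measure on the labels subconverge narrowly to a Borel family, and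
the convergence extends to integrands that are continuous on the compact set only. -/
theorem exists_subseq_timeTensor_map {T : ℝ} (hT : 0 < T) (m : Measure W) [IsProbabilityMeasure m]
    {B : Set W} (hB : MeasurableSet B) (hmB : m Bᶜ = 0) {K : Set Z} (hK : IsCompact K)
    (Y : ℕ → ℝ → W → Z) (hY : ∀ n, ContinuousOn (fun p : ℝ × W => Y n p.1 p.2) (Icc 0 T ×ˢ B))
    (hYK : ∀ n, ∀ t ∈ Icc 0 T, ∀ w ∈ B, Y n t w ∈ K) :
    ∃ k : ℕ → ℕ, StrictMono k ∧ ∃ η : Kernel ℝ Z, IsMarkovKernel η ∧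
      NarrowConverges (fun n => timeTensor T (fun t => m.map (Y (k n) t))) (timeTensor T η) ∧
      timeTensor T η (Icc 0 T ×ˢ K)ᶜ = 0 ∧
      ∀ g : ℝ × Z → ℝ, ContinuousOn g (Icc 0 T ×ˢ K) →
        Tendsto (fun n => ∫ w, (∫ t in Icc 0 T, g (t, Y (k n) t w)) ∂m) atTop
          (𝓝 (∫ p, g p ∂(timeTensor T η))) := by
  set M := (volume.restrict (Icc 0 T)).prod m with hM
  have hMB : ∀ᵐ p ∂M, p ∈ Icc 0 T ×ˢ B := by
    have h1 : ∀ᵐ t ∂(volume.restrict (Icc 0 T)), t ∈ Icc 0 T := ae_restrict_mem measurableSet_Icc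
    have h2 : ∀ᵐ w ∂m, w ∈ B := by rwa [ae_iff]
    filter_upwards [Measure.quasiMeasurePreserving_fst.ae h1,
      Measure.quasiMeasurePreserving_snd.ae h2] with p hp1 hp2 using ⟨hp1, hp2⟩
  have hYm : ∀ n, AEMeasurable (fun p : ℝ × W => Y n p.1 p.2) M := fun n => by
    have := (hY n).aemeasurable (μ := M) (measurableSet_Icc.prod hB)
    rwa [Measure.restrict_eq_self_of_ae_mem hMB] at this
  have hYm' : ∀ n, AEMeasurable (fun p : ℝ × W => (p.1, Y n p.1 p.2)) M := fun n =>
    measurable_fst.aemeasurable.prodMk (hYm n)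
  set μ : ℕ → Measure (ℝ × Z) := fun n => timeTensor T (fun t => m.map (Y n t)) with hμ
  have hμmap : ∀ n, μ n = M.map (fun p => (p.1, Y n p.1 p.2)) := fun n =>
    timeTensor_map T m (Y n) (hYm n)
  have hKc : IsCompact (Icc 0 T ×ˢ K) := isCompact_Icc.prod hK
  have hKm : MeasurableSet (Icc 0 T ×ˢ K) := hKc.measurableSet
  have hμK : ∀ n, μ n (Icc 0 T ×ˢ K)ᶜ = 0 := fun n => by
    rw [hμmap, Measure.map_apply_of_aemeasurable (hYm' n) hKm.compl]
    rw [measure_eq_zero_iff_ae_notMem]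
    filter_upwards [hMB] with p hp hp'
    exact hp' ⟨hp.1, hYK n p.1 hp.1 p.2 hp.2⟩
  have hfst : ∀ n, (μ n).fst = volume.restrict (Icc 0 T) := fun n => by
    rw [hμmap, Measure.fst, AEMeasurable.map_map_of_aemeasurable measurable_fst.aemeasurable
      (hYm' n)]
    exact Measure.fst_prod
  have hmass : ∀ n, μ n univ = ENNReal.ofReal T := fun n => by
    rw [← Measure.fst_univ, hfst, Measure.restrict_apply_univ, Real.volume_Icc, sub_zero]
  have : ∀ n, IsFiniteMeasure (μ n) := fun n => ⟨by simp [hmass n]⟩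
  obtain ⟨ν, hν, hνK, k, hk, hlim⟩ := exists_subseq_narrowConverges_of_measure_univ_eq hKc
    (c := ENNReal.ofReal T) (by simpa using hT) ENNReal.ofReal_ne_top μ hmass hμK
  obtain ⟨η, hη, rfl⟩ := hlim.exists_kernel fun n => hfst (k n)
  refine ⟨k, hk, η, hη, hlim, hνK, fun g hg => ?_⟩
  -- Fubini with time inside, so that estimates along single trajectories can be averaged over the
  -- labels.
  have hint : ∀ n, ∫ w, (∫ t in Icc 0 T, g (t, Y n t w)) ∂m = ∫ p, g p ∂(μ n) := fun n => by
    have hgi := integrable_of_continuousOn_of_isCompact hKc hKm (hμK n) hg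
    rw [hμmap] at hgi ⊢
    rw [integral_map (hYm' n) hgi.aestronglyMeasurable]
    rw [integrable_map_measure hgi.aestronglyMeasurable (hYm' n)] at hgi
    exact (integral_prod_symm _ hgi).symm
  simp only [hint]
  exact hlim.tendsto_integral_of_continuousOn hKc (fun n => hμK (k n)) hνK hg

end PushforwardLimit

/-! ### The control equation along one trajectory -/

section Trajectory

variable {d : ℕ} {T : ℝ} {E : ℝ → StateSpace d → ℝ} {f : StateSpace d → StateSpace d}

theorem continuous_gradient {φ : StateSpace d → ℝ} (hφ : ContDiff ℝ 1 φ) :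
    Continuous (gradient φ) :=
  (InnerProductSpace.toDual ℝ (StateSpace d)).symm.continuous.comp
    (hφ.continuous_fderiv one_ne_zero)

/-- The weak form of the control equation along a single trajectory. -/
theorem IsControlledSolution.integral_control_eq_zero (hT : 0 < T) (hf : ControlAssumptions d f)
    {ε : ℝ} {z₀ : StateSpace d × StateSpace d} {γ : ℝ → StateSpace d × StateSpace d}
    (h : IsControlledSolution T E f ε z₀ γ) {φ : StateSpace d → ℝ} (hφ : ContDiff ℝ 1 φ)
    {χ : ℝ → ℝ} (hχ : ContDiffOn ℝ 1 χ (Icc 0 T)) (h0 : χ 0 = 0) (h1 : χ T = 0) :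
    ∫ t in Icc 0 T, (derivWithin χ (Icc 0 T) t * φ (γ t).2 +
      χ t * inner ℝ (gradient φ (γ t).2) (f (γ t).2)) = 0 := by
  have hu : ContinuousOn (fun t => (γ t).2) (Icc 0 T) := h.continuousOn.snd
  have hderiv : ∀ t ∈ Icc 0 T, HasDerivWithinAt (fun t => χ t * φ (γ t).2)
      (derivWithin χ (Icc 0 T) t * φ (γ t).2 +
        χ t * inner ℝ (gradient φ (γ t).2) (f (γ t).2)) (Icc 0 T) t := fun t ht => by
    have hφ' := ((hφ.differentiable one_ne_zero) (γ t).2).hasFDerivAt.comp_hasDerivWithinAt t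
      (h.control t ht)
    rw [← inner_gradient_left] at hφ'
    exact ((hχ.differentiableOn one_ne_zero) t ht).hasDerivWithinAt.mul hφ'
  have hcont : ContinuousOn (fun t => derivWithin χ (Icc 0 T) t * φ (γ t).2 +
      χ t * inner ℝ (gradient φ (γ t).2) (f (γ t).2)) (Icc 0 T) :=
    ((hχ.continuousOn_derivWithin (uniqueDiffOn_Icc hT) le_rfl).mul
      (hφ.continuous.comp_continuousOn hu)).add (hχ.continuousOn.mul
        (((continuous_gradient hφ).comp_continuousOn hu).inner
          (hf.locallyLipschitz.continuous.comp_continuousOn hu)))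
  rw [integral_Icc_eq_integral_Ioc, ← intervalIntegral.integral_of_le hT.le,
    intervalIntegral.integral_eq_sub_of_hasDerivAt_of_le hT.le
      (fun t ht => (hderiv t ht).continuousWithinAt)
      (fun t ht => (hderiv t (Ioo_subset_Icc_self ht)).hasDerivAt (Icc_mem_nhds ht.1 ht.2))
      (hcont.intervalIntegrable_of_Icc hT.le)]
  simp [h0, h1]

end Trajectory

/-! ### The main theorem -/

theorem proposition3p5 (d : ℕ) (T : ℝ) (hT : 0 < T)
    (E : ℝ → StateSpace d → ℝ) (hE : EnergyAssumptions d T E)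
    (f : StateSpace d → StateSpace d) (hf : ControlAssumptions d f)
    (η₀ : Measure (StateSpace d × StateSpace d)) [IsProbabilityMeasure η₀]
    (hη₀ : ∃ K : Set (StateSpace d × StateSpace d), IsCompact K ∧ η₀ Kᶜ = 0)
    (ε : ℕ → ℝ) (hε_pos : ∀ n, 0 < ε n) (hε_lim : Tendsto ε atTop (𝓝 0)) :
    ∃ k : ℕ → ℕ, StrictMono k ∧
    ∃ η : Kernel ℝ (StateSpace d × StateSpace d), IsMarkovKernel η ∧
      NarrowConverges (fun n => timeTensor T (meanFieldMeasure T E f η₀ (ε (k n))))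
        (timeTensor T η) ∧
      (∀ ψ : StateSpace d → StateSpace d, Continuous ψ → HasCompactSupport ψ →
        ∀ θ : ℝ → ℝ, ContinuousOn θ (Icc 0 T) →
          Integrable (fun p : ℝ × StateSpace d × StateSpace d =>
            θ p.1 * inner ℝ (gradient (E p.1) p.2.1 - p.2.2) (ψ p.2.1)) (timeTensor T η) ∧
          ∫ t in Icc 0 T, ∫ z, θ t * inner ℝ (gradient (E t) z.1 - z.2) (ψ z.1) ∂(η t) = 0) ∧
      ∫⁻ t in Icc 0 T, ∫⁻ z, ‖gradient (E t) z.1 - z.2‖ₑ ^ 2 ∂(η t) = 0 ∧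
      (∀ φ : StateSpace d → ℝ, IsC1Bounded φ →
        ∀ χ : ℝ → ℝ, ContDiffOn ℝ 1 χ (Icc 0 T) → χ 0 = 0 → χ T = 0 →
          Integrable (fun p : ℝ × StateSpace d × StateSpace d =>
            derivWithin χ (Icc 0 T) p.1 * φ p.2.2) (timeTensor T η) ∧
          Integrable (fun p : ℝ × StateSpace d × StateSpace d =>
            χ p.1 * inner ℝ (gradient φ p.2.2) (f p.2.2)) (timeTensor T η) ∧
          (∫ t in Icc 0 T, ∫ z, derivWithin χ (Icc 0 T) t * φ z.2 ∂(η t)) +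
            ∫ t in Icc 0 T, ∫ z, χ t * inner ℝ (gradient φ z.2) (f z.2) ∂(η t) = 0) := by

  obtain ⟨K₀, hK₀, hη₀K⟩ := hη₀
  obtain ⟨R, hR⟩ := hK₀.isBounded.subset_closedBall 0
  have hηR : η₀ (Metric.closedBall 0 R)ᶜ = 0 := measure_mono_null (compl_subset_compl.2 hR) hη₀K
  have hηR' : ∀ᵐ z ∂η₀, z ∈ Metric.closedBall 0 R := by rwa [ae_iff]
  obtain ⟨M, C, hMC⟩ := exists_controlledFlow_bound hT hE hf R
  obtain ⟨k, hk, η, hη, hlim, hsupp, hconv⟩ := exists_subseq_timeTensor_map hT η₀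
    (B := Metric.closedBall 0 R) Metric.isClosed_closedBall.measurableSet hηR
    (isCompact_closedBall (0 : StateSpace d × StateSpace d) M)
    (fun n t z => controlledFlow T E f (ε n) t z)
    (fun n => continuousOn_controlledFlow hT hE hf (hε_pos n) R)
    (fun n t ht z hz => (hMC (ε n) (hε_pos n) z hz).1 t ht)
  have hflow := fun n z => isControlledSolution_controlledFlow hT hE hf (hε_pos n) z
  set K : Set (ℝ × StateSpace d × StateSpace d) := Icc 0 T ×ˢ Metric.closedBall 0 M with hK
  have hKc : IsCompact K := isCompact_Icc.prod (isCompact_closedBall _ _)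
  have htensor := timeTensor_kernel T η
  have hfin : IsFiniteMeasure (timeTensor T η) := by rw [htensor]; infer_instance
  have hint : ∀ g : ℝ × StateSpace d × StateSpace d → ℝ, ContinuousOn g K →
      Integrable g (timeTensor T η) := fun g hg =>
    integrable_of_continuousOn_of_isCompact hKc hKc.measurableSet hsupp hg
  have hfub : ∀ g : ℝ × StateSpace d × StateSpace d → ℝ, Integrable g (timeTensor T η) →
      ∫ t in Icc 0 T, ∫ z, g (t, z) ∂(η t) = ∫ p, g p ∂(timeTensor T η) := fun g hg => by
    rw [htensor] at hg ⊢
    exact (Measure.integral_compProd hg).symm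
  -- The averaged dissipation is at most C ε, so the limit measure gives the nonnegative function
  -- |∇ₓE - u|² integral zero.
  have hcrit : ∀ᵐ p ∂(timeTensor T η), gradient (E p.1) p.2.1 - p.2.2 = 0 := by
    set g : ℝ × StateSpace d × StateSpace d → ℝ :=
      fun p => ‖gradient (E p.1) p.2.1 - p.2.2‖ ^ 2 with hg
    have hgc : ContinuousOn g K :=
      (((hE.continuousOn_gradient hT).comp (f := fun p : ℝ × StateSpace d × StateSpace d =>
        (p.1, p.2.1)) (by fun_prop) fun p hp => ⟨hp.1, mem_univ _⟩).sub
          (by fun_prop)).norm.pow 2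
    have hle : ∀ n,
        ∫ z, (∫ t in Icc 0 T, g (t, controlledFlow T E f (ε n) t z)) ∂η₀ ≤ C * ε n :=
      fun n => by
        have h0 : 0 ≤ᵐ[η₀] fun z => ∫ t in Icc 0 T, g (t, controlledFlow T E f (ε n) t z) :=
          Eventually.of_forall fun z => integral_nonneg fun t => by positivity
        refine (integral_mono_of_nonneg h0 (integrable_const (C * ε n)) ?_).trans (by simp)
        filter_upwards [hηR'] with z hz using (hMC (ε n) (hε_pos n) z hz).2
    have hlim0 : Tendsto (fun n => C * ε (k n)) atTop (𝓝 0) := by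
      simpa using (hε_lim.comp hk.tendsto_atTop).const_mul C
    have hle0 : ∫ p, g p ∂(timeTensor T η) ≤ 0 :=
      le_of_tendsto_of_tendsto' (hconv g hgc) hlim0 fun n => hle (k n)
    have hg0 : 0 ≤ g := fun p => by positivity
    have h := (integral_eq_zero_iff_of_nonneg hg0 (hint g hgc)).1
      (hle0.antisymm (integral_nonneg hg0))
    filter_upwards [h] with p hp
    simpa [hg] using hp
  refine ⟨k, hk, η, hη, hlim, fun ψ _ _ θ _ => ?_, ?_, fun φ hφ χ hχ h0 h1 => ?_⟩
  · have hae : (fun p : ℝ × StateSpace d × StateSpace d =>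
        θ p.1 * inner ℝ (gradient (E p.1) p.2.1 - p.2.2) (ψ p.2.1)) =ᵐ[timeTensor T η] 0 := by
      filter_upwards [hcrit] with p hp
      simp [hp]
    have hi := (integrable_zero _ _ _).congr hae.symm
    refine ⟨hi, (hfub _ hi).trans ?_⟩
    rw [integral_congr_ae hae]
    simp
  · rw [htensor] at hcrit
    have h := Measure.ae_ae_of_ae_compProd hcrit
    rw [lintegral_congr_ae (g := 0)]
    · simp
    filter_upwards [h] with t ht
    rw [lintegral_congr_ae (g := 0)]
    · simp
    filter_upwards [ht] with z hz
    simp [hz]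
  · have hφc : Continuous φ := hφ.1.continuous
    have hφ'c := continuous_gradient hφ.1
    have hfc := hf.locallyLipschitz.continuous
    have hfst : MapsTo Prod.fst K (Icc 0 T) := fun p hp => hp.1
    have hc₁ : ContinuousOn (fun p : ℝ × StateSpace d × StateSpace d =>
        derivWithin χ (Icc 0 T) p.1 * φ p.2.2) K :=
      ((hχ.continuousOn_derivWithin (uniqueDiffOn_Icc hT) le_rfl).comp continuousOn_fst
        hfst).mul (by fun_prop)
    have hc₂ : ContinuousOn (fun p : ℝ × StateSpace d × StateSpace d =>
        χ p.1 * inner ℝ (gradient φ p.2.2) (f p.2.2)) K :=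
      (hχ.continuousOn.comp continuousOn_fst hfst).mul (by fun_prop)
    refine ⟨hint _ hc₁, hint _ hc₂, ?_⟩
    rw [hfub _ (hint _ hc₁), hfub _ (hint _ hc₂), ← integral_add (hint _ hc₁) (hint _ hc₂)]
    -- The integral of the sum is the limit of averages of the trajectory identity, each of which is
    -- zero.
    refine tendsto_nhds_unique (hconv _ (hc₁.add hc₂)) ?_
    refine tendsto_const_nhds.congr fun n => ?_
    symm
    exact (integral_congr_ae (Eventually.of_forall fun z =>
      (hflow (k n) z).integral_control_eq_zero hT hf hφ.1 hχ h0 h1)).trans (by simp)
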